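/- \textbf{Arithmetic.} Let $(q_j)_{j\in J}$ be a (finite or infinite) family of black-box operations, each $q_j$ a complex polynomial in $k_j\ge 0$ inputs. The available operations are exact negation and the rounded operations $x_1x_2$, $x_1+x_2$, $x_1-x_2$, $x\mapsto c\,x$ for every $c\in\mathbb{C}$, and $q_j$ for every $j\in J$; a rounded operation returns $op(a_1,\dots,a_l)(1+\delta)$ instead of $op(a_1,\dots,a_l)$, where each executed operation has its own error $\delta\in\mathbb{C}$. An algorithm on $\mathbb{C}^n$ is a finite directed acyclic graph of such operations applied to the exact inputs $x_1,\dots,x_n$ and to previously computed values, which may also branch on comparisons of two computed values, the comparison relations being taken from any fixed set (the empty set gives algorithms without branching); $p_{comp}(x,\delta)$ denotes its output. A polynomial $p$ is \emph{accurately evaluable} on $\mathbb{C}^n$ if there is an algorithm with $p_{comp}(x,0)=p(x)$ for all $x \in \mathbb{C}^n$ such that for every $0<\eta<1$ there is $0<\epsilon<1$ with $|p_{comp}(x,\delta)-p(x)|\le\eta\,|p(x)|$ for all $x\in\mathbb{C}^n$ and all $\delta$ with $|\delta_i|\le\epsilon$ for all $i$. \textbf{The varieties.} Let $q$ be a polynomial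 in $y_1,\dots,y_k$, let $K_Z\subseteq\{1,\dots,k\}$, and let $K_D,K_S$ be sets of pairs $(i,j)$ with $1\le i<j\le k$. Impose $y_i=0$ for $i\in K_Z$, $y_i=y_j$ for $(i,j)\in K_D$ and $y_i=-y_j$ for $(i,j)\in K_S$; let $K_R$ be the set of the remaining independent variables (those not forced to be zero, and not forced to be equal up to sign to a variable with smaller index) and $\tilde q$ the polynomial $q$ rewritten in these variables. Let $T\subseteq K_R$, $K_N\subseteq K_R\setminus T$, and write $\tilde q=\sum_\alpha q_\alpha\, y_T^\alpha$ with $q_\alpha$ polynomials in the variables in $K_R\setminus T$. For $\mathcal I=(T,K_Z,K_D,K_S,K_N)$ and an injective assignment of coordinates of $\mathbb{C}^n$ to the variables in $K_R\setminus T$, let $V_{\mathcal I}(q)\subseteq\mathbb{C}^n$ be the set of common zeros of all $q_\alpha$, after negating the variables in $K_N$. \textbf{Theorem.} Suppose that all black-box operations $q_j$, $j\in J$, are affine (of degree at most $1$). Let $n\ge 1$ and let $p$ be a complex polynomial in $n$ variables; if $p$ is a nonzero constant, suppose in addition that some $q_j$ has a nonzero constant term. Then $p$ is accurately evaluable on $\mathbb{C}^n$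 if and only if its zero set $V(p)=\{x\in\mathbb{C}^n: p(x)=0\}$ is a union of sets of the form $V_{\mathcal I}(q)$, where $q$ is one of the rounded operations listed above. -/

import Mathlib

noncomputable section

namespace AccEval

open MvPolynomial

/-- A black-box operation: a complex polynomial in finitely many inputs. -/
structure BlackBox where
  arity : ℕ
  poly : MvPolynomial (Fin arity) ℂ

/-- The rounded operations of the extended arithmetic: the traditional `×`, `+`, `-`,
multiplication by a complex constant, and the given black boxes `q j`. -/
inductive Op (J : Type*) where
  | mul : Op J
  | add : Op J
  | sub : Op J
  | smul (c : ℂ) : Op J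
  | box (j : J) : Op J

/-- The polynomial computed (before rounding) by an operation. -/
def Op.toBlackBox {J : Type*} (q : J → BlackBox) : Op J → BlackBox
  | .mul => ⟨2, X 0 * X 1⟩
  | .add => ⟨2, X 0 + X 1⟩
  | .sub => ⟨2, X 0 - X 1⟩
  | .smul c => ⟨1, C c * X 0⟩
  | .box j => q j

/-! ### Algorithms -/

/-- A finite algorithm whose memory currently holds `m` numbers. Every number that has been
computed stays available, so results can be shared between later operations (a DAG). `cmp` is
the set of comparison relations on which the algorithm may branch; `cmp = ∅` gives the
algorithms without branching. -/
inductive Alg {J : Type*} (q : J → BlackBox) (cmp : Set (ℂ → ℂ → Prop)) : ℕ → Type _ where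
  /-- stop and return the number in cell `i` -/
  | output {m : ℕ} (i : Fin m) : Alg q cmp m
  /-- append the exact negative of cell `i` to the memory -/
  | neg {m : ℕ} (i : Fin m) (next : Alg q cmp (m + 1)) : Alg q cmp m
  /-- append the rounded result of the operation `o` to the memory -/
  | op {m : ℕ} (o : Op J) (args : Fin (o.toBlackBox q).arity → Fin m)
      (next : Alg q cmp (m + 1)) : Alg q cmp m
  /-- compare the cells `i` and `j` by `R` and branch -/
  | branch {m : ℕ} (R : ℂ → ℂ → Prop) (hR : R ∈ cmp) (i j : Fin m)
      (yes no : Alg q cmp m) : Alg q cmp m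

open Classical in
/-- The computed output `p_comp(x, δ)`. The operation whose result is stored in cell number `m`
has its own relative error `δ m`, so different operations in a run have independent errors. -/
def Alg.run {J : Type*} {q : J → BlackBox} {cmp : Set (ℂ → ℂ → Prop)} (δ : ℕ → ℂ) :
    {m : ℕ} → Alg q cmp m → (Fin m → ℂ) → ℂ
  | _, .output i, mem => mem i
  | m, .neg i next, mem => next.run δ (Fin.snoc (α := fun _ : Fin (m + 1) => ℂ) mem (-mem i))
  | m, .op o args next, mem =>
      next.run δ (Fin.snoc (α := fun _ : Fin (m + 1) => ℂ) mem
        (eval (fun a => mem (args a)) (o.toBlackBox q).poly * (1 + δ m)))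
  | _, .branch R _ i j yes no, mem =>
      if R (mem i) (mem j) then yes.run δ mem else no.run δ mem

/-- `A` computes `p` exactly on `D` without rounding errors, and it is accurate: for every desired
relative error `η` there is a machine precision `ε` that guarantees it on all of `D`. -/
def Alg.IsAccurate {J : Type*} {q : J → BlackBox} {cmp : Set (ℂ → ℂ → Prop)} {n : ℕ}
    (A : Alg q cmp n) (p : MvPolynomial (Fin n) ℂ) (D : Set (Fin n → ℂ)) : Prop :=
  (∀ x ∈ D, A.run 0 x = eval x p) ∧
  ∀ η : ℝ, 0 < η → η < 1 → ∃ ε : ℝ, 0 < ε ∧ ε < 1 ∧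
    ∀ x ∈ D, ∀ δ : ℕ → ℂ, (∀ i, ‖δ i‖ ≤ ε) →
      ‖A.run δ x - eval x p‖ ≤ η * ‖eval x p‖

/-- `p` is accurately evaluable on `D`. -/
def AccuratelyEvaluable {J : Type*} (q : J → BlackBox) (cmp : Set (ℂ → ℂ → Prop)) {n : ℕ}
    (p : MvPolynomial (Fin n) ℂ) (D : Set (Fin n → ℂ)) : Prop :=
  ∃ A : Alg q cmp n, A.IsAccurate p D

/-! ### The varieties `V_𝓘(q)` -/

/-- The conditions imposed on the `k` inputs of a black box: `x_i = 0` for `i ∈ Z`,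
`x_i = x_j` for `(i, j) ∈ D`, and `x_i = -x_j` for `(i, j) ∈ S`. -/
structure Conditions (k : ℕ) where
  Z : Set (Fin k)
  D : Set (Fin k × Fin k)
  S : Set (Fin k × Fin k)
  D_lt : ∀ e ∈ D, e.1 < e.2
  S_lt : ∀ e ∈ S, e.1 < e.2

namespace Conditions

variable {k : ℕ} (K : Conditions k)

/-- The points that satisfy all the conditions. -/
def space : Set (Fin k → ℂ) :=
  {u | (∀ i ∈ K.Z, u i = 0) ∧ (∀ e ∈ K.D, u e.1 = u e.2) ∧ (∀ e ∈ K.S, u e.1 = -u e.2)}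

/-- The conditions force `x_i = 0`. -/
def Zero (i : Fin k) : Prop := ∀ u ∈ K.space, u i = 0

/-- The conditions force `x_i = x_j`. -/
def Same (i j : Fin k) : Prop := ∀ u ∈ K.space, u i = u j

/-- The conditions force `x_i = -x_j`. -/
def Opp (i j : Fin k) : Prop := ∀ u ∈ K.space, u i = -u j

/-- The set `K_R` of the remaining independent variables: those that are neither zero nor equal
up to sign to an earlier variable. -/
def remaining : Set (Fin k) := {i | ¬ K.Zero i ∧ ∀ j < i, ¬ K.Same i j ∧ ¬ K.Opp i j}

open Classical in
/-- The first variable that equals `x_i` up to sign. -/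
def rep (i : Fin k) : Fin k :=
  (Finset.univ.filter fun j => K.Same i j ∨ K.Opp i j).min'
    ⟨i, Finset.mem_filter.mpr ⟨Finset.mem_univ i, Or.inl fun _ _ => rfl⟩⟩

open Classical in
/-- The expression of `x_i` through the remaining independent variables. -/
def subst (i : Fin k) : MvPolynomial (Fin k) ℂ :=
  if K.Zero i then 0 else if K.Same i (K.rep i) then X (K.rep i) else -X (K.rep i)

/-- The polynomial `p`, rewritten subject to the conditions. -/
def rewrite (p : MvPolynomial (Fin k) ℂ) : MvPolynomial (Fin k) ℂ := bind₁ K.subst p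

end Conditions

open Classical in
/-- The expansion of `p` in the variables `x_T`: a polynomial in `x_T` whose coefficients are
polynomials in the other variables. -/
def expandIn {k : ℕ} (T : Set (Fin k)) (p : MvPolynomial (Fin k) ℂ) :
    MvPolynomial (Fin k) (MvPolynomial (Fin k) ℂ) :=
  aeval (fun i => if i ∈ T then X i else C (X i)) p

/-- An index `𝓘 = (T, K_Z, K_D, K_S, K_N)` for a black box with `k` inputs, together with the
coordinates of `ℂⁿ` that the remaining variables outside `T` stand for. -/
structure Index (k n : ℕ) extends Conditions k where
  T : Set (Fin k)
  N : Set (Fin k)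
  place : Fin k → Fin n
  T_subset : T ⊆ toConditions.remaining
  N_subset : N ⊆ toConditions.remaining \ T
  place_injOn : Set.InjOn place (toConditions.remaining \ T)

open Classical in
/-- `V_𝓘(p)` as a subset of `ℂⁿ`: the common zeros of the coefficients of the expansion in `x_T`
of the rewritten polynomial, with the variables in `N` negated. (The coefficients involve only the
remaining variables outside `T`.) -/
def Index.variety {k n : ℕ} (I : Index k n) (p : MvPolynomial (Fin k) ℂ) : Set (Fin n → ℂ) :=
  {x | ∀ α, eval (fun i => if i ∈ I.N then -x (I.place i) else x (I.place i))
    (coeff α (expandIn I.T (I.rewrite p))) = 0}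

/-- The sets `V_𝓘(q_j)` in `ℂⁿ`, for all operations `q_j` of the arithmetic and all `𝓘`. -/
def IsBasic {J : Type*} (q : J → BlackBox) {n : ℕ} (V : Set (Fin n → ℂ)) : Prop :=
  ∃ (o : Op J) (I : Index (o.toBlackBox q).arity n), V = I.variety (o.toBlackBox q).poly

end AccEval

end

noncomputable section

namespace AccEval

open MvPolynomial Filter Topology

/-! ### Polynomials -/

/-! Necessity: a run is executed symbolically, each path giving a polynomial in the errors with
coefficients in `ℂ[x]`. Let `f` be an irreducible factor of `p ≠ 0`. Accuracy bounds, at every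
point, some nonzero output by `2‖p‖`, so on `f = 0` the product of the nonzero outputs vanishes for
all small errors, hence identically in them. By the Nullstellensatz and primality, `f` divides one
nonzero output (`Alg.IsAccurate.exists_dvd_output`).

This divisibility must first arise at some operation. A product creates none, as `f` is prime. In an
affine operation each argument is, up to sign, zero, an input, or an earlier result carrying its own
factor `1 + δ_j`; differentiating in these errors shows that all earlier results cancel
(`fiber_sum_eq_zero`). What remains is an affine polynomial in the inputs divisible by `f`, hence
associated to `f`, and its zero set is a basic variety with the earlier results as free variables
`T` (`exists_variety_eq_of_dvd_aeval`). So `V(p)` is the union of the basic sets `V(f)`.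

Sufficiency: through each point of a basic variety passes the zero set, contained in the variety, of
a polynomial of degree at most one that is computable up to a factor near 1
(`IsBasic.exists_avail_factor`). If these varieties cover `V(p)`, such polynomials divide `p`, and
each irreducible factor of `p` is associated to one of them (`avail_of_irreducible_dvd`).
Multiplying the factors evaluates `p`; only nonzero constants need a black box with a constant term.
-/

theorem dvd_of_eval_eq_zero {n : ℕ} {f g : MvPolynomial (Fin n) ℂ} (hf : Prime f)
    (h : ∀ x, eval x f = 0 → eval x g = 0) : f ∣ g := by
  have hP : (Ideal.span {f}).IsPrime := (Ideal.span_singleton_prime hf.ne_zero).2 hf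
  -- Nullstellensatz: a prime ideal is the vanishing ideal of its zero locus.
  rw [← Ideal.mem_span_singleton,
    ← MvPolynomial.IsPrime.vanishingIdeal_zeroLocus (K := ℂ) (Ideal.span {f})]
  rw [mem_vanishingIdeal_iff]
  intro x hx
  rw [zeroLocus_span] at hx
  simpa [aeval_eq_eval] using h x (by simpa [aeval_eq_eval] using hx)

theorem eq_affine_of_totalDegree_le_one {k : ℕ} {p : MvPolynomial (Fin k) ℂ}
    (hp : p.totalDegree ≤ 1) :
    p = C (constantCoeff p) + ∑ i, C (coeff (Finsupp.single i 1) p) * X i := by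
  classical
  ext α
  by_cases h0 : α = 0
  · subst h0
    simp [coeff_sum, coeff_C_mul, constantCoeff_eq]
  by_cases h1 : ∃ i, α = Finsupp.single i 1
  · obtain ⟨i, rfl⟩ := h1
    simp only [coeff_add, coeff_C, coeff_sum, coeff_C_mul, coeff_X]
    rw [if_neg (by simp [eq_comm])]
    simp [Finsupp.single_left_inj]
  · rw [coeff_eq_zero_of_totalDegree_lt]
    · simp only [coeff_add, coeff_C, coeff_sum, coeff_C_mul, coeff_X]
      rw [if_neg (fun h => h0 h.symm), Finset.sum_eq_zero, add_zero]
      intro i _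
      rw [if_neg (fun h => h1 ⟨i, h.symm⟩), mul_zero]
    · refine lt_of_le_of_lt hp ?_
      by_contra hlt
      have hle : α.degree ≤ 1 := by
        rw [Finsupp.degree_apply]
        omega
      rcases Nat.le_one_iff_eq_zero_or_eq_one.1 hle with h | h
      · exact h0 ((Finsupp.degree_eq_zero_iff α).1 h)
      · exact h1 ((Finsupp.sum_eq_one_iff α).1 h)

theorem aeval_eq_affine {k : ℕ} {A : Type*} [CommSemiring A] [Algebra ℂ A]
    {p : MvPolynomial (Fin k) ℂ} (hp : p.totalDegree ≤ 1) (y : Fin k → A) :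
    aeval y p = algebraMap ℂ A (constantCoeff p) +
      ∑ i, algebraMap ℂ A (coeff (Finsupp.single i 1) p) * y i := by
  conv_lhs => rw [eq_affine_of_totalDegree_le_one hp]
  simp only [map_add, map_sum, map_mul, aeval_C, aeval_X]

theorem irreducible_of_totalDegree_le_one {n : ℕ} {l : MvPolynomial (Fin n) ℂ} (hl : l ≠ 0)
    (hu : ¬ IsUnit l) (hd : l.totalDegree ≤ 1) : Irreducible l := by
  have h1 : l.totalDegree = 1 := by
    refine le_antisymm hd (Nat.one_le_iff_ne_zero.2 fun h0 => hu ?_)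
    refine isUnit_iff_totalDegree_of_isReduced.2 ⟨?_, h0⟩
    rw [totalDegree_eq_zero_iff_eq_C.1 h0] at hl
    exact isUnit_iff_ne_zero.2 fun h' => hl (by rw [h', C_0])
  refine irreducible_of_totalDegree_eq_one h1 fun x hx => ?_
  refine isUnit_iff_ne_zero.2 fun hx0 => hl ?_
  ext α
  simpa [hx0] using hx α

theorem associated_of_dvd_of_totalDegree_le_one {n : ℕ} {f l : MvPolynomial (Fin n) ℂ}
    (hf : Irreducible f) (hl : l ≠ 0) (hd : l.totalDegree ≤ 1) (h : f ∣ l) : Associated f l :=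
  hf.associated_of_dvd (irreducible_of_totalDegree_le_one hl
    (fun hu => hf.not_isUnit (isUnit_of_dvd_unit h hu)) hd) h

/-- Applied with `h` a difference of two functions, this replaces one by the other wherever they
agree off the fibres whose weights cancel. -/
theorem sum_mul_eq_zero_of_fiber {ι κ R : Type*} [Fintype ι] [DecidableEq κ] [CommSemiring R]
    (w : ι → R) (b : ι → κ) (h : κ → R)
    (hw : ∀ y, h y ≠ 0 → ∑ i with b i = y, w i = 0) : ∑ i, w i * h (b i) = 0 := by
  rw [← Finset.sum_fiberwise_of_maps_to (t := Finset.univ.image b) (g := b) (by simp)]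
  refine Finset.sum_eq_zero fun y _ => ?_
  have : ∑ i with b i = y, w i * h (b i) = (∑ i with b i = y, w i) * h y := by
    rw [Finset.sum_mul]
    refine Finset.sum_congr rfl fun i hi => ?_
    rw [(Finset.mem_filter.1 hi).2]
  rw [this]
  by_cases hy : h y = 0
  · rw [hy, mul_zero]
  · rw [hw y hy, zero_mul]

/-! ### The varieties as conditions on a substitution -/

open Classical in
/-- The sign with which `rep i` enters the expression of `x_i`. -/
def Conditions.sign {k : ℕ} (K : Conditions k) (i : Fin k) : ℂ :=
  if K.Zero i then 0 else if K.Same i (K.rep i) then 1 else -1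

open Classical in
/-- The value at `x` of the remaining variable `i`, the variables in `T` being left free. -/
def Index.point {k n : ℕ} (I : Index k n) (x : Fin n → ℂ) (i : Fin k) : MvPolynomial (Fin k) ℂ :=
  if i ∈ I.T then X i else C (if i ∈ I.N then -x (I.place i) else x (I.place i))

theorem Conditions.sign_cases {k : ℕ} (K : Conditions k) (i : Fin k) :
    K.sign i = 0 ∨ K.sign i = 1 ∨ K.sign i = -1 := by
  unfold Conditions.sign
  split_ifs <;> simp

/-- Evaluating the coefficients at `x` commutes with the expansion in `T`, so the vanishing of all
coefficients is one polynomial identity after a single substitution. -/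
theorem Index.mem_variety_iff {k n : ℕ} (I : Index k n) (p : MvPolynomial (Fin k) ℂ)
    (x : Fin n → ℂ) :
    x ∈ I.variety p ↔ aeval (fun i => C (I.sign i) * I.point x (I.rep i)) p = 0 := by
  classical
  have hX : ∀ i, map (eval fun i => if i ∈ I.N then -x (I.place i) else x (I.place i))
      (aeval (fun i => if i ∈ I.T then X i else C (X i)) (I.subst i)) =
        C (I.sign i) * I.point x (I.rep i) := by
    intro i
    unfold Conditions.subst Conditions.sign Index.point
    by_cases hZ : I.Zero i
    · rw [if_pos hZ, if_pos hZ, map_zero, map_zero, C_0, zero_mul]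
    rw [if_neg hZ, if_neg hZ]
    by_cases hT : I.rep i ∈ I.T
    · by_cases hS : I.Same i (I.rep i)
      · simp only [if_pos hS, if_pos hT, aeval_X, map_X, C_1, one_mul]
      · simp only [if_neg hS, if_pos hT, map_neg, aeval_X, map_X, C_1, neg_mul, one_mul]
    · by_cases hS : I.Same i (I.rep i)
      · simp only [if_pos hS, if_neg hT, aeval_X, map_C, eval_X, C_1, one_mul]
      · simp only [if_neg hS, if_neg hT, map_neg, aeval_X, map_C, eval_X, C_1, neg_mul, one_mul]
  have key : map (eval fun i => if i ∈ I.N then -x (I.place i) else x (I.place i))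
      (expandIn I.T (I.rewrite p)) = aeval (fun i => C (I.sign i) * I.point x (I.rep i)) p := by
    unfold expandIn Conditions.rewrite
    induction p using MvPolynomial.induction_on with
    | C a => simp [MvPolynomial.algebraMap_apply, algebraMap_eq]
    | add p q hp hq => simp only [map_add, hp, hq]
    | mul_X p i hp =>
      simp only [map_mul, hp, bind₁_X_right, aeval_X]
      rw [hX]
  rw [← key, MvPolynomial.ext_iff]
  simp only [Index.variety, Set.mem_ofPred_eq, coeff_map, coeff_zero]

/-! ### Indices from signed identifications of the inputs -/

section Signs

variable {k n : ℕ} (s : Fin k → ℂ) (b : Fin k → Fin n ⊕ ℕ)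

/-- The conditions satisfied by inputs of the form `u i = s i * v (b i)`. -/
def signConditions : Conditions k where
  Z := {i | s i = 0}
  D := {e | e.1 < e.2 ∧ b e.1 = b e.2 ∧ s e.1 = s e.2}
  S := {e | e.1 < e.2 ∧ b e.1 = b e.2 ∧ s e.1 = -s e.2}
  D_lt := fun _ h => h.1
  S_lt := fun _ h => h.1

theorem mem_space_signConditions (v : Fin n ⊕ ℕ → ℂ) :
    (fun i => s i * v (b i)) ∈ (signConditions s b).space := by
  refine ⟨fun i hi => ?_, fun e he => ?_, fun e he => ?_⟩
  · have : s i = 0 := hi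
    simp [this]
  · simp only
    rw [he.2.1, he.2.2]
  · simp only
    rw [he.2.1, he.2.2, neg_mul]

theorem signConditions_zero_iff (i : Fin k) : (signConditions s b).Zero i ↔ s i = 0 := by
  refine ⟨fun h => ?_, fun h u hu => hu.1 i h⟩
  simpa using h _ (mem_space_signConditions s b fun _ => 1)

theorem signConditions_same {i j : Fin k} (hb : b i = b j) (h : s i = s j) :
    (signConditions s b).Same i j := by
  intro u hu
  rcases lt_trichotomy i j with hij | rfl | hij
  · exact hu.2.1 (i, j) ⟨hij, hb, h⟩
  · rfl
  · exact (hu.2.1 (j, i) ⟨hij, hb.symm, h.symm⟩).symm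

theorem signConditions_opp {i j : Fin k} (hi : s i ≠ 0) (hb : b i = b j) (h : s i = -s j) :
    (signConditions s b).Opp i j := by
  intro u hu
  rcases lt_trichotomy i j with hij | rfl | hij
  · exact hu.2.2 (i, j) ⟨hij, hb, h⟩
  · exact absurd (self_eq_neg.1 h) hi
  · have := hu.2.2 (j, i) ⟨hij, hb.symm, by simp [h]⟩
    simp only at this
    rw [this, neg_neg]

variable (hs : ∀ i, s i = 0 ∨ s i = 1 ∨ s i = -1)

include hs in
theorem signConditions_same_or_opp_iff {i j : Fin k} (hi : s i ≠ 0) :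
    (signConditions s b).Same i j ∨ (signConditions s b).Opp i j ↔ s j ≠ 0 ∧ b j = b i := by
  classical
  constructor
  · intro h
    -- The indicator of the fibre of `i` is an admissible point that vanishes on all other fibres.
    have hu := mem_space_signConditions s b (Pi.single (b i) 1)
    have : s j * (Pi.single (b i) 1 : Fin n ⊕ ℕ → ℂ) (b j) ≠ 0 := by
      rcases h with h | h <;> have := h _ hu <;> simp only [Pi.single_eq_same, mul_one] at this
      · rwa [← this]
      · intro h0
        rw [h0, neg_zero] at this
        exact hi this
    refine ⟨left_ne_zero_of_mul this, ?_⟩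
    by_contra hne
    exact this (by rw [Pi.single_eq_of_ne hne, mul_zero])
  · rintro ⟨hj, hb⟩
    by_cases h : s i = s j
    · exact Or.inl (signConditions_same s b hb.symm h)
    · refine Or.inr (signConditions_opp s b hi hb.symm ?_)
      rcases hs i with h1 | h1 | h1 <;> rcases hs j with h2 | h2 | h2 <;> simp_all

include hs in
theorem signConditions_rep {i : Fin k} (hi : s i ≠ 0) :
    s ((signConditions s b).rep i) ≠ 0 ∧ b ((signConditions s b).rep i) = b i := by
  rw [← signConditions_same_or_opp_iff s b hs hi]
  classical
  have := Finset.min'_mem (Finset.univ.filter fun j =>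
    (signConditions s b).Same i j ∨ (signConditions s b).Opp i j)
    ⟨i, Finset.mem_filter.mpr ⟨Finset.mem_univ i, Or.inl fun _ _ => rfl⟩⟩
  exact (Finset.mem_filter.1 this).2

include hs in
theorem signConditions_rep_le {i j : Fin k} (hi : s i ≠ 0) (hj : s j ≠ 0) (hb : b j = b i) :
    (signConditions s b).rep i ≤ j := by
  classical
  refine Finset.min'_le _ _ (Finset.mem_filter.2 ⟨Finset.mem_univ _, ?_⟩)
  exact (signConditions_same_or_opp_iff s b hs hi).2 ⟨hj, hb⟩

include hs in
theorem signConditions_rep_eq {i j : Fin k} (hi : s i ≠ 0) (hj : s j ≠ 0) (hb : b i = b j) :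
    (signConditions s b).rep i = (signConditions s b).rep j := by
  have h1 := signConditions_rep s b hs hi
  have h2 := signConditions_rep s b hs hj
  exact le_antisymm (signConditions_rep_le s b hs hi h2.1 (h2.2.trans hb.symm))
    (signConditions_rep_le s b hs hj h1.1 (h1.2.trans hb))

include hs in
theorem signConditions_mem_remaining_iff (i : Fin k) :
    i ∈ (signConditions s b).remaining ↔ s i ≠ 0 ∧ ∀ j < i, s j ≠ 0 → b j ≠ b i := by
  unfold Conditions.remaining
  rw [Set.mem_ofPred_eq, signConditions_zero_iff]
  refine and_congr_right fun hi => forall₂_congr fun j _ => ?_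
  rw [← not_or, signConditions_same_or_opp_iff s b hs hi, not_and]

include hs in
theorem signConditions_rep_mem_remaining {i : Fin k} (hi : s i ≠ 0) :
    (signConditions s b).rep i ∈ (signConditions s b).remaining := by
  have h := signConditions_rep s b hs hi
  refine (signConditions_mem_remaining_iff s b hs _).2 ⟨h.1, fun j hj hsj hb => ?_⟩
  exact absurd (signConditions_rep_le s b hs hi hsj (hb.trans h.2)) (not_le.2 hj)

include hs in
theorem signConditions_sign (i : Fin k) (hi : s i ≠ 0) :
    (signConditions s b).sign i = s i * s ((signConditions s b).rep i) := by
  have h := signConditions_rep s b hs hi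
  unfold Conditions.sign
  rw [signConditions_zero_iff, if_neg hi]
  have hiff : (signConditions s b).Same i ((signConditions s b).rep i) ↔
      s i = s ((signConditions s b).rep i) := by
    refine ⟨fun hS => ?_, signConditions_same s b h.2.symm⟩
    simpa using hS _ (mem_space_signConditions s b fun _ => 1)
  rw [hiff]
  revert h
  generalize (signConditions s b).rep i = r
  intro h
  rcases hs i with h1 | h1 | h1
  · exact absurd h1 hi
  all_goals
    rcases hs r with h2 | h2 | h2
    · exact absurd h2 h.1
    all_goals
      rw [h1, h2]
      norm_num

/-- The index in which the inputs with `b i = .inr _` are free. -/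
def signIndex (i₀ : Fin n) : Index k n where
  toConditions := signConditions s b
  T := {i | i ∈ (signConditions s b).remaining ∧ (b i).isRight}
  N := {i | i ∈ (signConditions s b).remaining ∧ (b i).isLeft ∧ s i = -1}
  -- `i₀` is a dummy: a remaining variable labelled `.inr` lies in `T` and needs no coordinate.
  place := fun i => Sum.elim id (fun _ => i₀) (b i)
  T_subset := fun _ h => h.1
  N_subset := fun i h => ⟨h.1, fun hT => by
    have h1 := h.2.1
    have h2 := hT.2
    rw [← Sum.not_isLeft, h1] at h2
    simp at h2⟩
  place_injOn := by
    intro i hi j hj hij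
    have hi' := (signConditions_mem_remaining_iff s b hs i).1 hi.1
    have hj' := (signConditions_mem_remaining_iff s b hs j).1 hj.1
    have hb : b i = b j := by
      have h1 : ¬ (b i).isRight := fun h => hi.2 ⟨hi.1, h⟩
      have h2 : ¬ (b j).isRight := fun h => hj.2 ⟨hj.1, h⟩
      simp only at hij
      rcases hbi : b i with t | t <;> rcases hbj : b j with t' | t' <;> simp_all
    rcases lt_trichotomy i j with h | h | h
    · exact absurd hb (hj'.2 i h hi'.1)
    · exact h
    · exact absurd hb.symm (hi'.2 j h hj'.1)

/-- `hfree` makes the free variables cancel, leaving one affine equation in the coordinates. -/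
theorem signIndex_variety (i₀ : Fin n) {p : MvPolynomial (Fin k) ℂ} (hp : p.totalDegree ≤ 1)
    (hfree : ∀ j, ∑ i with b i = .inr j, coeff (Finsupp.single i 1) p * s i = 0) :
    (signIndex s b hs i₀).variety p = {x | constantCoeff p +
      ∑ i, coeff (Finsupp.single i 1) p * s i * Sum.elim x (fun _ => 0) (b i) = 0} := by
  classical
  ext x
  rw [Index.mem_variety_iff, Set.mem_ofPred_eq]
  let r := (signConditions s b).rep
  -- The common value of a fibre before signs. For a free fibre the chosen member is immaterial,
  -- since all members with nonzero sign share one representative.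
  let g : Fin n ⊕ ℕ → MvPolynomial (Fin k) ℂ := fun y =>
    Sum.elim (fun t => C (x t)) (fun _ =>
      if h : ∃ i, s i ≠ 0 ∧ b i = y then C (s (r h.choose)) * X (r h.choose) else 0) y
  have hg : ∀ i, C ((signIndex s b hs i₀).sign i) *
      (signIndex s b hs i₀).point x ((signIndex s b hs i₀).rep i) = C (s i) * g (b i) := by
    intro i
    change C ((signConditions s b).sign i) * (signIndex s b hs i₀).point x (r i) = _
    by_cases hi : s i = 0
    · have : (signConditions s b).sign i = 0 := by
        unfold Conditions.sign
        rw [signConditions_zero_iff, if_pos hi]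
      rw [this, hi, C_0, zero_mul, zero_mul]
    rw [signConditions_sign s b hs i hi, C_mul, mul_assoc]
    congr 1
    have hr := signConditions_rep s b hs hi
    have hrem := signConditions_rep_mem_remaining s b hs hi
    change C (s (r i)) * _ = _
    change s (r i) ≠ 0 ∧ b (r i) = b i at hr
    change r i ∈ _ at hrem
    unfold Index.point
    rcases hbi : b i with t | j
    · have hT : r i ∉ (signIndex s b hs i₀).T := fun h => by
        have := h.2
        rw [hr.2, hbi] at this
        simp at this
      have hpl : (signIndex s b hs i₀).place (r i) = t := by
        change Sum.elim id (fun _ => i₀) (b (r i)) = t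
        rw [hr.2, hbi]
        rfl
      have hN : r i ∈ (signIndex s b hs i₀).N ↔ s (r i) = -1 := by
        change (_ ∧ (b (r i)).isLeft ∧ _) ↔ _
        rw [hr.2, hbi]
        simp [hrem]
      rw [if_neg hT, hpl, ← C_mul]
      simp only [hN, g, Sum.elim_inl]
      congr 1
      -- The negation prescribed by `N` undoes the sign of the representative.
      rcases hs (r i) with h | h | h
      · exact absurd h hr.1
      · rw [h, if_neg (by norm_num)]
        ring
      · rw [h, if_pos rfl]
        ring
    · have hT : r i ∈ (signIndex s b hs i₀).T := ⟨hrem, by rw [hr.2, hbi]; rfl⟩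
      have hex : ∃ i, s i ≠ 0 ∧ b i = .inr j := ⟨i, hi, hbi⟩
      have : r hex.choose = r i := signConditions_rep_eq s b hs hex.choose_spec.1 hi
        (hex.choose_spec.2.trans hbi.symm)
      simp only [g, Sum.elim_inr]
      rw [if_pos hT, dif_pos hex, this]
  simp only [hg]
  have hsum : aeval (fun i => C (s i) * g (b i)) p = C (constantCoeff p +
      ∑ i, coeff (Finsupp.single i 1) p * s i * Sum.elim x (fun _ => 0) (b i)) := by
    rw [aeval_eq_affine hp]
    simp only [map_add, map_sum, map_mul, algebraMap_eq]
    congr 1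
    rw [← sub_eq_zero, ← Finset.sum_sub_distrib]
    have := sum_mul_eq_zero_of_fiber
      (fun i => (C (coeff (Finsupp.single i 1) p * s i) : MvPolynomial (Fin k) ℂ)) b
      (fun y => g y - C (Sum.elim x (fun _ => 0) y)) (by
        rintro (t | j) hy
        · simp [g] at hy
        · rw [← map_sum, hfree, C_0])
    rw [← this]
    refine Finset.sum_congr rfl fun i _ => ?_
    rw [C_mul]
    ring
  rw [hsum, C_eq_zero]

end Signs

/-! ### Symbolic execution -/

/-- Polynomials in the rounding errors whose coefficients are polynomials in the inputs. -/
abbrev SymPoly (n : ℕ) := MvPolynomial ℕ (MvPolynomial (Fin n) ℂ)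

/-- Evaluation at inputs `x` and rounding errors `δ`. -/
def evalSym {n : ℕ} (x : Fin n → ℂ) (δ : ℕ → ℂ) : SymPoly n →+* ℂ :=
  (eval x).comp (eval fun i => C (δ i))

theorem evalSym_apply {n : ℕ} (x : Fin n → ℂ) (δ : ℕ → ℂ) (L : SymPoly n) :
    evalSym x δ L = eval x (eval (fun i => C (δ i)) L) := rfl

theorem evalSym_eq_eval_map {n : ℕ} (x : Fin n → ℂ) (δ : ℕ → ℂ) (L : SymPoly n) :
    evalSym x δ L = eval δ (map (eval x) L) := by
  rw [evalSym_apply]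
  induction L using MvPolynomial.induction_on with
  | C a => simp
  | add p q hp hq => simp only [map_add, hp, hq]
  | mul_X p i hp => simp only [map_mul, hp, eval_X, map_X, eval_C]

theorem evalSym_aeval {n k : ℕ} (x : Fin n → ℂ) (δ : ℕ → ℂ) (y : Fin k → SymPoly n)
    (p : MvPolynomial (Fin k) ℂ) :
    evalSym x δ (aeval y p) = eval (fun i => evalSym x δ (y i)) p := by
  induction p using MvPolynomial.induction_on with
  | C a => simp [evalSym_apply, MvPolynomial.algebraMap_apply]
  | add p q hp hq => simp only [map_add, hp, hq]
  | mul_X p i hp => simp only [map_mul, hp, eval_X, aeval_X]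

/-- The results of all the computation paths of an algorithm. -/
def Alg.outputs {J : Type*} {q : J → BlackBox} {cmp : Set (ℂ → ℂ → Prop)} {n : ℕ} :
    {m : ℕ} → Alg q cmp m → (Fin m → SymPoly n) → List (SymPoly n)
  | _, .output i, mem => [mem i]
  | m, .neg i next, mem =>
      next.outputs (Fin.snoc (α := fun _ : Fin (m + 1) => SymPoly n) mem (-mem i))
  | m, .op o args next, mem =>
      next.outputs (Fin.snoc (α := fun _ : Fin (m + 1) => SymPoly n) mem
        (aeval (fun a => mem (args a)) (o.toBlackBox q).poly * (1 + X m)))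
  | _, .branch _ _ _ _ yes no, mem => yes.outputs mem ++ no.outputs mem

/-- Comparisons only select a path, so no property of the relations in `cmp` is needed. -/
theorem Alg.exists_outputs_eq_run {J : Type*} {q : J → BlackBox} {cmp : Set (ℂ → ℂ → Prop)}
    {n m : ℕ} (A : Alg q cmp m) (x : Fin n → ℂ) (δ : ℕ → ℂ) (mem : Fin m → SymPoly n) :
    ∃ L ∈ A.outputs mem, A.run δ (fun i => evalSym x δ (mem i)) = evalSym x δ L := by
  have hsnoc : ∀ {m : ℕ} (mem : Fin m → SymPoly n) (v : SymPoly n),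
      (fun i => evalSym x δ (Fin.snoc (α := fun _ : Fin (m + 1) => SymPoly n) mem v i)) =
        Fin.snoc (α := fun _ : Fin (m + 1) => ℂ) (fun i => evalSym x δ (mem i))
          (evalSym x δ v) := fun mem v => Fin.comp_snoc _ mem v
  induction A with
  | output i => exact ⟨mem i, by simp [Alg.outputs], rfl⟩
  | neg i next ih =>
    have := ih (Fin.snoc (α := fun _ => SymPoly n) mem (-mem i))
    rwa [hsnoc, map_neg] at this
  | @op m o args next ih =>
    have := ih (Fin.snoc (α := fun _ => SymPoly n) mem
        (aeval (fun a => mem (args a)) (o.toBlackBox q).poly * (1 + X m)))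
    rw [hsnoc, map_mul, evalSym_aeval, map_add, map_one] at this
    have hX : evalSym x δ (X m) = δ m := by simp [evalSym_apply]
    rwa [hX] at this
  | branch R hR i j yes no ihy ihn =>
    obtain ⟨L, hL, h⟩ := ihy mem
    obtain ⟨L', hL', h'⟩ := ihn mem
    unfold Alg.outputs Alg.run
    split_ifs
    · exact ⟨L, List.mem_append_left _ hL, h⟩
    · exact ⟨L', List.mem_append_right _ hL', h'⟩

/-! ### Tracing a divisor back to an operation -/

/-- The values of the inputs and of the rounded operations, `Y j` being the result of the
operation in cell `j` before rounding. -/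
def baseValue {n : ℕ} (Y : ℕ → SymPoly n) : Fin n ⊕ ℕ → SymPoly n :=
  Sum.elim (fun t => C (X t)) (fun j => Y j * (1 + X j))

/-- `v` is zero or, up to sign, an input or the result of a rounded operation in a cell
before `m`. -/
def IsSigned {n : ℕ} (Y : ℕ → SymPoly n) (m : ℕ) (v : SymPoly n) : Prop :=
  ∃ (s : ℂ) (b : Fin n ⊕ ℕ), (s = 0 ∨ s = 1 ∨ s = -1) ∧ (∀ j, b = .inr j → j < m) ∧
    v = C (C s) * baseValue Y b

/-- The memory contains only signed inputs and results of operations; these results are not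
divisible by `f` and have independent errors. -/
def Tracked {n : ℕ} (f : MvPolynomial (Fin n) ℂ) {m : ℕ} (mem : Fin m → SymPoly n) : Prop :=
  ∃ Y : ℕ → SymPoly n, (∀ j l, j ≤ l → pderiv l (Y j) = 0) ∧ (∀ j, ¬ C f ∣ Y j) ∧
    ∀ i, IsSigned Y m (mem i)

section Trace

variable {n : ℕ} {f : MvPolynomial (Fin n) ℂ} {Y : ℕ → SymPoly n}

theorem baseValue_inl (Y : ℕ → SymPoly n) (t : Fin n) : baseValue Y (.inl t) = C (X t) := rfl

theorem baseValue_congr {Y' : ℕ → SymPoly n} {b : Fin n ⊕ ℕ}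
    (h : ∀ j, b = .inr j → Y' j = Y j) : baseValue Y' b = baseValue Y b := by
  rcases b with t | j
  · rw [baseValue_inl, baseValue_inl]
  · exact congrArg (· * (1 + X j)) (h j rfl)

theorem pderiv_baseValue_of_lt (hY : ∀ j l, j ≤ l → pderiv l (Y j) = 0) {b : Fin n ⊕ ℕ} {l : ℕ}
    (hb : ∀ j, b = .inr j → j < l) : pderiv l (baseValue Y b) = 0 := by
  rcases b with t | j
  · simp [baseValue]
  · have hj := hb j rfl
    simp [baseValue, Derivation.leibniz, hY j l hj.le, pderiv_X_of_ne hj.ne]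

theorem pderiv_baseValue_self (hY : ∀ j l, j ≤ l → pderiv l (Y j) = 0) (j : ℕ) :
    pderiv j (baseValue Y (.inr j)) = Y j := by
  simp [baseValue, Derivation.leibniz, hY j j le_rfl]

theorem pderiv_C_mul (j : ℕ) (c : MvPolynomial (Fin n) ℂ) (v : SymPoly n) :
    pderiv j (C c * v) = C c * pderiv j v := by
  simp [Derivation.leibniz]

theorem IsSigned.pderiv_eq_zero (hY : ∀ j l, j ≤ l → pderiv l (Y j) = 0) {m : ℕ} {v : SymPoly n}
    (hv : IsSigned Y m v) {l : ℕ} (hl : m ≤ l) : pderiv l v = 0 := by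
  obtain ⟨s, b, -, hb, rfl⟩ := hv
  rw [pderiv_C_mul, pderiv_baseValue_of_lt hY fun j hj => (hb j hj).trans_le hl, mul_zero]

theorem isUnit_C_C {c : ℂ} (hc : c ≠ 0) : IsUnit (C (C c) : SymPoly n) :=
  ((isUnit_iff_ne_zero.2 hc).map C).map C

theorem not_dvd_one_add_X (hf : Irreducible f) (j : ℕ) : ¬ C f ∣ (1 + X j : SymPoly n) := by
  intro h
  rw [C_dvd_iff_dvd_coeff] at h
  have := h 0
  simp only [coeff_add, coeff_zero_one, coeff_zero_X, add_zero] at this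
  exact hf.not_isUnit (isUnit_of_dvd_one this)

theorem IsSigned.not_dvd (hf : Irreducible f) (hX : ∀ t, ¬ f ∣ X t) (hYf : ∀ j, ¬ C f ∣ Y j)
    {m : ℕ} {v : SymPoly n} (hv : IsSigned Y m v) (h0 : v ≠ 0) : ¬ C f ∣ v := by
  obtain ⟨s, b, -, -, rfl⟩ := hv
  have hs : s ≠ 0 := by
    rintro rfl
    simp at h0
  rw [(isUnit_C_C hs).dvd_mul_left]
  have hP : Prime (C f : SymPoly n) := (prime_C_iff ℕ).2 hf.prime
  rcases b with t | j
  · intro h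
    rw [C_dvd_iff_dvd_coeff] at h
    exact hX t (by simpa [baseValue] using h 0)
  · intro h
    rcases hP.dvd_or_dvd h with h | h
    · exact hYf j h
    · exact not_dvd_one_add_X hf j h

theorem dvd_pderiv {g : MvPolynomial (Fin n) ℂ} {v : SymPoly n} (h : C g ∣ v) (j : ℕ) :
    C g ∣ pderiv j v := by
  obtain ⟨w, rfl⟩ := h
  rw [pderiv_C_mul]
  exact dvd_mul_right _ _

/-- Descending induction on `j`: differentiation in the error `j` kills constants, inputs and
earlier results, while later results already cancel. This leaves the fibre sum times `Y j`, which
`f` can divide only if the sum is zero. -/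
theorem fiber_sum_eq_zero (hY : ∀ j l, j ≤ l → pderiv l (Y j) = 0)
    (hYf : ∀ j, ¬ C f ∣ Y j) {k : ℕ} (c : ℂ) (w : Fin k → ℂ) (b : Fin k → Fin n ⊕ ℕ)
    {m : ℕ} (hb : ∀ i j, b i = .inr j → j < m)
    (hdvd : C f ∣ C (C c) + ∑ i, C (C (w i)) * baseValue Y (b i)) (j : ℕ) :
    ∑ i with b i = .inr j, w i = 0 := by
  induction hd : m - j using Nat.strong_induction_on generalizing j with
  | _ d ih =>
    by_cases hj : m ≤ j
    · refine Finset.sum_eq_zero fun i hi => ?_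
      exact absurd (hb i j (Finset.mem_filter.1 hi).2) (not_lt.2 hj)
    have hlater : ∀ l, j < l → ∑ i with b i = .inr l, w i = 0 := fun l hl =>
      ih (m - l) (by omega) l rfl
    have hd := dvd_pderiv hdvd j
    simp only [map_add, map_sum, pderiv_C, zero_add, pderiv_C_mul] at hd
    have hsum : ∑ i, C (C (w i)) * pderiv j (baseValue Y (b i)) =
        C (C (∑ i with b i = .inr j, w i)) * Y j := by
      rw [← Finset.sum_filter_add_sum_filter_not _ (fun i => b i = .inr j), map_sum, map_sum,
        Finset.sum_mul]
      have h2 : ∑ i with ¬ b i = .inr j, C (C (w i)) * pderiv j (baseValue Y (b i)) = 0 := by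
        rw [Finset.sum_filter]
        refine (Finset.sum_congr rfl fun i _ => ?_).trans
          (sum_mul_eq_zero_of_fiber (fun i => (C (C (w i)) : SymPoly n)) b
            (fun y => if y = .inr j then 0 else pderiv j (baseValue Y y)) ?_)
        · by_cases h : b i = .inr j <;> simp [h]
        · intro y hy
          rcases y with t | l
          · simp [baseValue] at hy
          rw [← map_sum, ← map_sum, hlater l, C_0, C_0]
          by_contra hl
          rcases (not_lt.1 hl).eq_or_lt with rfl | hlt
          · simp at hy
          · rw [pderiv_baseValue_of_lt hY] at hy
            · simp at hy
            · rintro _ ⟨⟩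
              exact hlt
      rw [h2, add_zero]
      refine Finset.sum_congr rfl fun i hi => ?_
      rw [(Finset.mem_filter.1 hi).2, pderiv_baseValue_self hY]
    rw [hsum] at hd
    by_contra hne
    rw [(isUnit_C_C hne).dvd_mul_left] at hd
    exact hYf j hd

theorem add_sum_baseValue_eq_C {k : ℕ} (c : ℂ) (w : Fin k → ℂ) (b : Fin k → Fin n ⊕ ℕ)
    (hfib : ∀ j, ∑ i with b i = .inr j, w i = 0) :
    C (C c) + ∑ i, C (C (w i)) * baseValue Y (b i) =
      C (C c + ∑ i, C (w i) * Sum.elim X (fun _ => 0) (b i)) := by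
  have h := sum_mul_eq_zero_of_fiber (fun i => (C (C (w i)) : SymPoly n)) b
      (fun y => baseValue Y y - C (Sum.elim X (fun _ => 0) y)) (by
    rintro (t | j) ht
    · simp [baseValue] at ht
    · rw [← map_sum, ← map_sum, hfib, C_0, C_0])
  simp only [mul_sub, Finset.sum_sub_distrib] at h
  rw [sub_eq_zero.1 h]
  simp only [map_add, map_sum, map_mul]

theorem aeval_affine {k : ℕ} {p : MvPolynomial (Fin k) ℂ} (hp : p.totalDegree ≤ 1)
    (y : Fin k → SymPoly n) : aeval y p = C (C (constantCoeff p)) +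
      ∑ i, C (C (coeff (Finsupp.single i 1) p)) * y i := by
  rw [aeval_eq_affine hp]
  simp only [MvPolynomial.algebraMap_apply, algebraMap_eq]

/-- An affine operation whose result is divisible by an irreducible polynomial `f`, though none of
its arguments is, has the zero set of `f` among its varieties. -/
theorem exists_variety_eq_of_dvd_aeval (hn : 0 < n) (hf : Irreducible f)
    (hY : ∀ j l, j ≤ l → pderiv l (Y j) = 0) (hYf : ∀ j, ¬ C f ∣ Y j)
    {k m : ℕ} {p : MvPolynomial (Fin k) ℂ} (hp : p.totalDegree ≤ 1) {y : Fin k → SymPoly n}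
    (hy : ∀ i, IsSigned Y m (y i)) (h0 : aeval y p ≠ 0) (hdvd : C f ∣ aeval y p) :
    ∃ I : Index k n, {x | eval x f = 0} = I.variety p := by
  classical
  choose s b hs hb hyi using hy
  let w : Fin k → ℂ := fun i => coeff (Finsupp.single i 1) p * s i
  let l : MvPolynomial (Fin n) ℂ := C (constantCoeff p) + ∑ i, C (w i) * Sum.elim X (fun _ => 0) (b i)
  have hv : aeval y p = C (C (constantCoeff p)) + ∑ i, C (C (w i)) * baseValue Y (b i) := by
    rw [aeval_affine hp]
    refine congrArg _ (Finset.sum_congr rfl fun i _ => ?_)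
    rw [hyi, C_mul, C_mul, mul_assoc]
  have hfib := fiber_sum_eq_zero hY hYf _ w b hb (hv ▸ hdvd)
  have hl : aeval y p = C l := hv.trans (add_sum_baseValue_eq_C _ w b hfib)
  have hl0 : l ≠ 0 := by
    rintro h
    rw [hl, h, C_0] at h0
    exact h0 rfl
  have hfl : f ∣ l := by
    rw [hl, C_dvd_iff_dvd_coeff] at hdvd
    simpa using hdvd 0
  have hdeg : l.totalDegree ≤ 1 := by
    refine (totalDegree_add _ _).trans (max_le (by simp) ?_)
    refine totalDegree_finsetSum_le fun i _ => (totalDegree_mul _ _).trans ?_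
    rw [totalDegree_C, zero_add]
    rcases b i with t | j <;> simp
  obtain ⟨u, hu⟩ := (associated_of_dvd_of_totalDegree_le_one hf hl0 hdeg hfl).symm
  refine ⟨signIndex s b hs ⟨0, hn⟩, ?_⟩
  rw [signIndex_variety s b hs ⟨0, hn⟩ hp hfib]
  ext x
  have hux : eval x (u : MvPolynomial (Fin n) ℂ) ≠ 0 := (u.isUnit.map (eval x)).ne_zero
  rw [Set.mem_ofPred_eq, Set.mem_ofPred_eq, ← hu, map_mul, mul_eq_zero, or_iff_left hux]
  simp only [l, map_add, map_sum, map_mul, eval_C, w]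
  have : ∀ i, eval x (Sum.elim X (fun _ => 0) (b i)) = Sum.elim x (fun _ => 0) (b i) := by
    intro i
    rcases b i with t | j <;> simp
  simp only [this]

end Trace

theorem totalDegree_C_mul_X_le (c : ℂ) :
    (C c * X 0 : MvPolynomial (Fin 1) ℂ).totalDegree ≤ 1 :=
  (totalDegree_mul _ _).trans (by rw [totalDegree_C, totalDegree_X, zero_add])

theorem aeval_X_mul_X {A : Type*} [CommSemiring A] [Algebra ℂ A] (y : Fin 2 → A) :
    aeval y (X 0 * X 1 : MvPolynomial (Fin 2) ℂ) = y 0 * y 1 := by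
  rw [map_mul, aeval_X, aeval_X]

theorem Op.eq_mul_or_totalDegree_le_one {J : Type*} {q : J → BlackBox}
    (hq : ∀ j, (q j).poly.totalDegree ≤ 1) (o : Op J) :
    o = .mul ∨ (o.toBlackBox q).poly.totalDegree ≤ 1 := by
  cases o with
  | mul => exact Or.inl rfl
  | add =>
    have : (X 0 + X 1 : MvPolynomial (Fin 2) ℂ).totalDegree ≤ 1 :=
      (totalDegree_add _ _).trans (by simp [totalDegree_X])
    exact Or.inr this
  | sub =>
    have : (X 0 - X 1 : MvPolynomial (Fin 2) ℂ).totalDegree ≤ 1 :=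
      (totalDegree_sub _ _).trans (by simp [totalDegree_X])
    exact Or.inr this
  | smul c => exact Or.inr (totalDegree_C_mul_X_le c)
  | box j => exact Or.inr (hq j)

/-- Old cells refer only to results before `m`, so `Y` may be redefined from `m` on. -/
theorem Tracked.snoc_signed {n m : ℕ} {f : MvPolynomial (Fin n) ℂ} {Y Y' : ℕ → SymPoly n}
    {mem : Fin m → SymPoly n} {v : SymPoly n}
    (hY : ∀ j l, j ≤ l → pderiv l (Y' j) = 0) (hYf : ∀ j, ¬ C f ∣ Y' j)
    (hYY : ∀ j < m, Y' j = Y j) (hmem : ∀ i, IsSigned Y m (mem i)) (hv : IsSigned Y' (m + 1) v) :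
    Tracked f (Fin.snoc (α := fun _ : Fin (m + 1) => SymPoly n) mem v) := by
  refine ⟨Y', hY, hYf, fun i => ?_⟩
  induction i using Fin.lastCases with
  | last => rwa [Fin.snoc_last]
  | cast i =>
    rw [Fin.snoc_castSucc]
    obtain ⟨s, b, hs, hb, h⟩ := hmem i
    refine ⟨s, b, hs, fun j hj => (hb j hj).trans (Nat.lt_succ_self m), ?_⟩
    rw [h, baseValue_congr fun j hj => hYY j (hb j hj)]

/-- `Tracked f` is preserved along every path; `hX` excludes divisibility already present in the
inputs. -/
theorem Alg.not_dvd_of_mem_outputs {J : Type*} {q : J → BlackBox}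
    (hq : ∀ j, (q j).poly.totalDegree ≤ 1) {cmp : Set (ℂ → ℂ → Prop)} {n m : ℕ} (hn : 0 < n)
    {f : MvPolynomial (Fin n) ℂ} (hf : Irreducible f) (hX : ∀ t, ¬ f ∣ X t)
    (hbasic : ¬ IsBasic q {x | eval x f = 0}) (A : Alg q cmp m) {mem : Fin m → SymPoly n}
    (hmem : Tracked f mem) {L : SymPoly n} (hL : L ∈ A.outputs mem) (hL0 : L ≠ 0) :
    ¬ C f ∣ L := by
  have hP : Prime (C f : SymPoly n) := (prime_C_iff ℕ).2 hf.prime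
  induction A with
  | output i =>
    obtain ⟨Y, -, hYf, h⟩ := hmem
    simp only [Alg.outputs, List.mem_singleton] at hL
    subst hL
    exact (h i).not_dvd hf hX hYf hL0
  | neg i next ih =>
    obtain ⟨Y, hY, hYf, h⟩ := hmem
    refine ih (Tracked.snoc_signed hY hYf (fun _ _ => rfl) h ?_) hL
    obtain ⟨s, b, hs, hb, h⟩ := h i
    refine ⟨-s, b, ?_, fun j hj => (hb j hj).trans (Nat.lt_succ_self _), ?_⟩
    · rcases hs with rfl | rfl | rfl <;> simp
    · rw [h, map_neg, map_neg]
      exact (neg_mul (C (C s) : SymPoly n) (baseValue Y b)).symm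
  | @op m o args next ih =>
    obtain ⟨Y, hY, hYf, h⟩ := hmem
    refine ih ?_ hL
    set v := aeval (fun a => mem (args a)) (o.toBlackBox q).poly with hv
    -- Zero is divisible by `f` and cannot serve as `Y m`; it is recorded as `0` times an input.
    by_cases hv0 : v = 0
    · refine Tracked.snoc_signed hY hYf (fun _ _ => rfl) h ⟨0, .inl ⟨0, hn⟩, ?_, ?_, ?_⟩ <;>
        simp [hv0]
    have hvd : ∀ l, m ≤ l → pderiv l v = 0 := by
      intro l hl
      rcases o.eq_mul_or_totalDegree_le_one hq with rfl | ho
      · have hv' : v = mem (args (0 : Fin 2)) * mem (args (1 : Fin 2)) :=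
          aeval_X_mul_X (fun a : Fin 2 => mem (args a))
        rw [hv', Derivation.leibniz, (h _).pderiv_eq_zero hY hl, (h _).pderiv_eq_zero hY hl]
        simp
      · rw [hv, aeval_affine ho]
        simp only [map_add, map_sum, pderiv_C, pderiv_C_mul]
        simp [(h _).pderiv_eq_zero hY hl]
    have hvf : ¬ C f ∣ v := by
      intro hd
      rcases o.eq_mul_or_totalDegree_le_one hq with rfl | ho
      · have hv' : v = mem (args (0 : Fin 2)) * mem (args (1 : Fin 2)) :=
          aeval_X_mul_X (fun a : Fin 2 => mem (args a))
        rw [hv'] at hd hv0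
        rcases hP.dvd_or_dvd hd with hd | hd
        · exact (h _).not_dvd hf hX hYf (left_ne_zero_of_mul hv0) hd
        · exact (h _).not_dvd hf hX hYf (right_ne_zero_of_mul hv0) hd
      · obtain ⟨I, hI⟩ := exists_variety_eq_of_dvd_aeval hn hf hY hYf ho
          (fun a => h (args a)) hv0 hd
        exact hbasic ⟨o, I, hI⟩
    refine Tracked.snoc_signed (Y' := Function.update Y m v) ?_ ?_ ?_ h ?_
    · intro j l hjl
      rcases eq_or_ne j m with rfl | hj
      · rw [Function.update_self]
        exact hvd l hjl
      · rw [Function.update_of_ne hj]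
        exact hY j l hjl
    · intro j
      rcases eq_or_ne j m with rfl | hj
      · rwa [Function.update_self]
      · rw [Function.update_of_ne hj]
        exact hYf j
    · intro j hj
      rw [Function.update_of_ne hj.ne]
    · refine ⟨1, .inr m, by simp, ?_, by simp [baseValue]⟩
      rintro _ ⟨⟩
      exact Nat.lt_succ_self m
  | branch R hR i j yes no ihy ihn =>
    rcases List.mem_append.1 hL with hL | hL
    · exact ihy hmem hL
    · exact ihn hmem hL

theorem tracked_inputs {n : ℕ} {f : MvPolynomial (Fin n) ℂ} (hf : Irreducible f) :
    Tracked f (fun i : Fin n => (C (X i) : SymPoly n)) := by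
  refine ⟨fun _ => 1, by simp, fun _ h => ?_, fun i => ⟨1, .inl i, by simp, by simp, ?_⟩⟩
  · exact ((prime_C_iff ℕ).2 hf.prime).not_isUnit (isUnit_of_dvd_one h)
  · simp [baseValue]

/-! ### Factors of accurately evaluable polynomials -/

theorem dense_eval_ne_zero {n : ℕ} {p : MvPolynomial (Fin n) ℂ} (hp : p ≠ 0) :
    Dense {x : Fin n → ℂ | eval x p ≠ 0} := by
  rw [Metric.dense_iff]
  intro x r hr
  by_contra hempty
  refine hp (funext_set (fun i => Metric.ball (x i) r)
    (fun i => infinite_of_mem_nhds (x i) (Metric.ball_mem_nhds _ hr)) fun y hy => ?_)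
  rw [map_zero]
  by_contra hne
  refine hempty ⟨y, ?_, hne⟩
  rw [Metric.mem_ball, dist_pi_lt_iff hr]
  exact fun i => hy i trivial

/-- Where `p` is nonzero, accuracy with `η = 1/2` forces the output of the path taken to be nonzero
and bounded. For fixed `δ` the condition is closed, there being finitely many outputs, so it extends
from this dense set to all points. -/
theorem Alg.IsAccurate.exists_output_le {J : Type*} {q : J → BlackBox}
    {cmp : Set (ℂ → ℂ → Prop)} {n : ℕ} {A : Alg q cmp n} {p : MvPolynomial (Fin n) ℂ}
    (hA : A.IsAccurate p Set.univ) (hp : p ≠ 0) :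
    ∃ ε : ℝ, 0 < ε ∧ ∀ x : Fin n → ℂ, ∀ δ : ℕ → ℂ, (∀ i, ‖δ i‖ ≤ ε) →
      ∃ L ∈ A.outputs (fun i => C (X i)), L ≠ 0 ∧ ‖evalSym x δ L‖ ≤ 2 * ‖eval x p‖ := by
  obtain ⟨ε, hε, -, h⟩ := hA.2 (1 / 2) (by norm_num) (by norm_num)
  refine ⟨ε, hε, fun x δ hδ => ?_⟩
  let outs := A.outputs (n := n) (fun i => C (X i))
  have hclosed : IsClosed {x : Fin n → ℂ | ∃ L ∈ outs, L ≠ 0 ∧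
      ‖evalSym x δ L‖ ≤ 2 * ‖eval x p‖} := by
    have : {x : Fin n → ℂ | ∃ L ∈ outs, L ≠ 0 ∧ ‖evalSym x δ L‖ ≤ 2 * ‖eval x p‖} =
        ⋃ L ∈ {L | L ∈ outs ∧ L ≠ 0}, {x | ‖evalSym x δ L‖ ≤ 2 * ‖eval x p‖} := by
      ext x
      simp [and_assoc]
    rw [this]
    refine Set.Finite.isClosed_biUnion ((List.finite_toSet outs).subset fun L hL => hL.1)
      fun L _ => ?_
    simp only [evalSym_apply]
    exact isClosed_le (continuous_eval _).norm (continuous_const.mul (continuous_eval _).norm)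
  refine (hclosed.closure_subset_iff.2 ?_) (dense_eval_ne_zero hp x)
  intro y hy
  obtain ⟨L, hL, hrun⟩ := A.exists_outputs_eq_run y δ (fun i => C (X i))
  have hmem : (fun i => evalSym y δ (C (X i))) = y := by
    ext i
    simp [evalSym_apply]
  rw [hmem] at hrun
  have hacc := h y trivial δ hδ
  rw [hrun] at hacc
  have hpos : 0 < ‖eval y p‖ := norm_pos_iff.2 hy
  refine ⟨L, hL, ?_, ?_⟩
  · rintro rfl
    rw [map_zero, zero_sub, norm_neg] at hacc
    linarith
  · have := norm_le_insert' (evalSym y δ L) (eval y p)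
    linarith

theorem Alg.IsAccurate.exists_dvd_output {J : Type*} {q : J → BlackBox}
    {cmp : Set (ℂ → ℂ → Prop)} {n : ℕ} {A : Alg q cmp n} {p f : MvPolynomial (Fin n) ℂ}
    (hA : A.IsAccurate p Set.univ) (hp : p ≠ 0) (hf : Irreducible f) (hfp : f ∣ p) :
    ∃ L ∈ A.outputs (fun i => C (X i)), L ≠ 0 ∧ C f ∣ L := by
  classical
  obtain ⟨ε, hε, h⟩ := hA.exists_output_le hp
  let outs := (A.outputs (n := n) (fun i => C (X i))).filter (· ≠ 0)
  have hP : Prime (C f : SymPoly n) := (prime_C_iff ℕ).2 hf.prime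
  have hdvd : C f ∣ outs.prod := by
    rw [C_dvd_iff_dvd_coeff]
    intro α
    refine dvd_of_eval_eq_zero hf.prime fun x hx => ?_
    have hpx : eval x p = 0 := by
      obtain ⟨g, rfl⟩ := hfp
      rw [map_mul, hx, zero_mul]
    -- Which output vanishes may depend on `δ`; their product vanishes for all small `δ`, hence as a
    -- polynomial.
    have hmap : map (eval x) outs.prod = 0 := by
      refine funext_set (fun _ => Metric.closedBall (0 : ℂ) ε)
        (fun _ => infinite_of_mem_nhds 0 (Metric.closedBall_mem_nhds _ hε)) fun δ hδ => ?_
      obtain ⟨L, hL, hL0, hle⟩ := h x δ fun i => by simpa using hδ i trivial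
      rw [hpx, norm_zero, mul_zero, norm_le_zero_iff] at hle
      rw [← evalSym_eq_eval_map, map_zero]
      refine zero_dvd_iff.1 ?_
      rw [← hle]
      exact map_dvd _ (List.dvd_prod (by simp [outs, hL, hL0]))
    rw [← coeff_map, hmap, coeff_zero]
  obtain ⟨L, hL, hfL⟩ := hP.dvd_prod_iff.1 hdvd
  rw [List.mem_filter] at hL
  exact ⟨L, hL.1, by simpa using hL.2, hfL⟩

theorem isBasic_X {J : Type*} (q : J → BlackBox) {n : ℕ} (t : Fin n) :
    IsBasic q {x : Fin n → ℂ | x t = 0} := by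
  refine ⟨.smul 1, signIndex (fun _ => 1) (fun _ => .inl t) (by simp) t, ?_⟩
  rw [signIndex_variety]
  · change _ = {x : Fin n → ℂ | constantCoeff (C 1 * X 0 : MvPolynomial (Fin 1) ℂ) +
      ∑ i : Fin 1, coeff (Finsupp.single i 1) (C 1 * X 0 : MvPolynomial (Fin 1) ℂ) * 1 * x t = 0}
    simp
  · exact totalDegree_C_mul_X_le 1
  · simp

theorem isBasic_univ {J : Type*} (q : J → BlackBox) {n : ℕ} (hn : 0 < n) :
    IsBasic q (Set.univ : Set (Fin n → ℂ)) := by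
  refine ⟨.smul 0, signIndex (fun _ => 1) (fun _ => .inl ⟨0, hn⟩) (by simp) ⟨0, hn⟩, ?_⟩
  ext x
  rw [Index.mem_variety_iff]
  change _ ↔ aeval _ (C 0 * X 0 : MvPolynomial (Fin 1) ℂ) = 0
  simp

theorem Alg.IsAccurate.isBasic_of_irreducible_dvd {J : Type*} {q : J → BlackBox}
    (hq : ∀ j, (q j).poly.totalDegree ≤ 1) {cmp : Set (ℂ → ℂ → Prop)} {n : ℕ} (hn : 0 < n)
    {A : Alg q cmp n} {p f : MvPolynomial (Fin n) ℂ}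
    (hA : A.IsAccurate p Set.univ) (hp : p ≠ 0) (hf : Irreducible f) (hfp : f ∣ p) :
    IsBasic q {x | eval x f = 0} := by
  by_contra hbasic
  obtain ⟨L, hL, hL0, hfL⟩ := hA.exists_dvd_output hp hf hfp
  refine A.not_dvd_of_mem_outputs hq hn hf (fun t ht => hbasic ?_) hbasic (tracked_inputs hf)
    hL hL0 hfL
  obtain ⟨u, hu⟩ := associated_of_dvd_of_totalDegree_le_one hf (X_ne_zero t) (by simp) ht
  convert! isBasic_X q t using 3 with x
  have hux : eval x (u : MvPolynomial (Fin n) ℂ) ≠ 0 := (u.isUnit.map (eval x)).ne_zero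
  rw [← eval_X (f := x) t, ← hu, map_mul, mul_eq_zero, or_iff_left hux]

theorem AccuratelyEvaluable.exists_eq_sUnion {J : Type*} {q : J → BlackBox}
    (hq : ∀ j, (q j).poly.totalDegree ≤ 1) {cmp : Set (ℂ → ℂ → Prop)} {n : ℕ} (hn : 0 < n)
    {p : MvPolynomial (Fin n) ℂ} (hA : AccuratelyEvaluable q cmp p Set.univ) :
    ∃ 𝒱 : Set (Set (Fin n → ℂ)), (∀ V ∈ 𝒱, IsBasic q V) ∧ {x | eval x p = 0} = ⋃₀ 𝒱 := by
  obtain ⟨A, hA⟩ := hA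
  rcases eq_or_ne p 0 with rfl | hp
  · refine ⟨{Set.univ}, ?_, by simp⟩
    rintro _ rfl
    exact isBasic_univ q hn
  -- For a nonzero constant `p` this family is empty, as is the zero set.
  refine ⟨{V | ∃ f, Irreducible f ∧ f ∣ p ∧ V = {x | eval x f = 0}}, ?_, ?_⟩
  · rintro _ ⟨f, hf, hfp, rfl⟩
    exact hA.isBasic_of_irreducible_dvd hq hn hp hf hfp
  · ext x
    constructor
    · intro hx
      obtain ⟨u, hu⟩ := UniqueFactorizationMonoid.factors_prod hp
      have hx0 : eval x (UniqueFactorizationMonoid.factors p).prod = 0 := by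
        have hux : eval x (u : MvPolynomial (Fin n) ℂ) ≠ 0 := (u.isUnit.map (eval x)).ne_zero
        have : eval x p = 0 := hx
        rw [← hu, map_mul, mul_eq_zero, or_iff_left hux] at this
        exact this
      rw [map_multiset_prod, Multiset.prod_eq_zero_iff, Multiset.mem_map] at hx0
      obtain ⟨f, hf, hfx⟩ := hx0
      exact ⟨_, ⟨f, UniqueFactorizationMonoid.irreducible_of_factor f hf,
        UniqueFactorizationMonoid.dvd_of_mem_factors hf, rfl⟩, hfx⟩
    · rintro ⟨_, ⟨f, -, ⟨g, rfl⟩, rfl⟩, hx⟩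
      have : eval x f = 0 := hx
      change eval x (f * g) = 0
      rw [map_mul, this, zero_mul]

/-! ### Straight-line programs -/

/-- `Reach q M` says that some straight-line program fills the memory with the values `M x δ`. -/
inductive Reach {J : Type*} (q : J → BlackBox) {n : ℕ} :
    {m : ℕ} → ((Fin n → ℂ) → (ℕ → ℂ) → Fin m → ℂ) → Prop where
  | inputs : Reach q fun x _ => x
  | neg {m : ℕ} {M : (Fin n → ℂ) → (ℕ → ℂ) → Fin m → ℂ} (i : Fin m) : Reach q M →
      Reach q fun x δ => Fin.snoc (α := fun _ : Fin (m + 1) => ℂ) (M x δ) (-M x δ i)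
  | op {m : ℕ} {M : (Fin n → ℂ) → (ℕ → ℂ) → Fin m → ℂ} (o : Op J)
      (args : Fin (o.toBlackBox q).arity → Fin m) : Reach q M →
      Reach q fun x δ => Fin.snoc (α := fun _ : Fin (m + 1) => ℂ) (M x δ)
        (eval (fun a => M x δ (args a)) (o.toBlackBox q).poly * (1 + δ m))

/-- Some cell of the memory holds the value `g`. -/
def Holds {n m : ℕ} (M : (Fin n → ℂ) → (ℕ → ℂ) → Fin m → ℂ)
    (g : (Fin n → ℂ) → (ℕ → ℂ) → ℂ) : Prop :=
  ∃ i, ∀ x δ, M x δ i = g x δ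

/-- Every straight-line program can be continued so that it computes an element of `G`. -/
def Avail {J : Type*} (q : J → BlackBox) {n : ℕ} (G : Set ((Fin n → ℂ) → (ℕ → ℂ) → ℂ)) : Prop :=
  ∀ (m : ℕ) (M : (Fin n → ℂ) → (ℕ → ℂ) → Fin m → ℂ), Reach q M →
    ∃ (m' : ℕ) (M' : (Fin n → ℂ) → (ℕ → ℂ) → Fin m' → ℂ), Reach q M' ∧
      (∀ g, Holds M g → Holds M' g) ∧ ∃ g ∈ G, Holds M' g

/-- The functions that differ from `p` by a factor close to one for small errors. -/
def approximants {n : ℕ} (p : MvPolynomial (Fin n) ℂ) : Set ((Fin n → ℂ) → (ℕ → ℂ) → ℂ) :=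
  {g | ∃ E : (ℕ → ℂ) → ℂ, Continuous E ∧ E 0 = 1 ∧ g = fun x δ => eval x p * E δ}

section StraightLine

variable {J : Type*} {q : J → BlackBox} {n : ℕ}

/-- `Reach` grows a program at its end and `Alg` at its start, so the statement carries an arbitrary
continuation. -/
theorem Reach.exists_alg (cmp : Set (ℂ → ℂ → Prop)) {m : ℕ}
    {M : (Fin n → ℂ) → (ℕ → ℂ) → Fin m → ℂ} (hM : Reach q M) (A : Alg q cmp m) :
    ∃ A' : Alg q cmp n, ∀ x δ, A'.run δ x = A.run δ (M x δ) := by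
  induction hM with
  | inputs => exact ⟨A, fun _ _ => rfl⟩
  | neg i _ ih => exact ih (.neg i A)
  | op o args _ ih => exact ih (.op o args A)

theorem Holds.snoc {m : ℕ} {M : (Fin n → ℂ) → (ℕ → ℂ) → Fin m → ℂ}
    {g : (Fin n → ℂ) → (ℕ → ℂ) → ℂ} (h : Holds M g) (v : (Fin n → ℂ) → (ℕ → ℂ) → ℂ) :
    Holds (fun x δ => Fin.snoc (α := fun _ : Fin (m + 1) => ℂ) (M x δ) (v x δ)) g := by
  obtain ⟨i, hi⟩ := h
  exact ⟨i.castSucc, fun x δ => (Fin.snoc_castSucc ..).trans (hi x δ)⟩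

theorem holds_snoc_last {m : ℕ} (M : (Fin n → ℂ) → (ℕ → ℂ) → Fin m → ℂ)
    (v : (Fin n → ℂ) → (ℕ → ℂ) → ℂ) :
    Holds (fun x δ => Fin.snoc (α := fun _ : Fin (m + 1) => ℂ) (M x δ) (v x δ)) v :=
  ⟨Fin.last m, fun _ _ => Fin.snoc_last ..⟩

theorem Reach.holds_input {m : ℕ} {M : (Fin n → ℂ) → (ℕ → ℂ) → Fin m → ℂ} (hM : Reach q M)
    (t : Fin n) : Holds M fun x _ => x t := by
  induction hM with
  | inputs => exact ⟨t, fun _ _ => rfl⟩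
  | neg i _ ih => exact ih.snoc _
  | op o args _ ih => exact ih.snoc _

theorem Avail.mono {G G' : Set ((Fin n → ℂ) → (ℕ → ℂ) → ℂ)} (h : Avail q G) (hG : G ⊆ G') :
    Avail q G' := by
  intro m M hM
  obtain ⟨m', M', hM', hext, g, hg, hh⟩ := h m M hM
  exact ⟨m', M', hM', hext, g, hG hg, hh⟩

theorem avail_input (t : Fin n) : Avail q {fun (x : Fin n → ℂ) (_ : ℕ → ℂ) => x t} :=
  fun _ M hM => ⟨_, M, hM, fun _ h => h, _, rfl, hM.holds_input t⟩

theorem Avail.neg {g : (Fin n → ℂ) → (ℕ → ℂ) → ℂ} (h : Avail q {g}) :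
    Avail q {fun x δ => -g x δ} := by
  intro m M hM
  obtain ⟨m', M', hM', hext, g, rfl, i, hi⟩ := h m M hM
  refine ⟨_, _, hM'.neg i, fun g' hg' => (hext g' hg').snoc _, _, rfl, ?_⟩
  simp only [← hi]
  exact holds_snoc_last M' fun x δ => -M' x δ i

theorem exists_reach_holds_all {k : ℕ} {G : Fin k → Set ((Fin n → ℂ) → (ℕ → ℂ) → ℂ)}
    (hG : ∀ i, Avail q (G i)) {m : ℕ} {M : (Fin n → ℂ) → (ℕ → ℂ) → Fin m → ℂ}
    (hM : Reach q M) : ∃ (m' : ℕ) (M' : (Fin n → ℂ) → (ℕ → ℂ) → Fin m' → ℂ), Reach q M' ∧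
      (∀ g, Holds M g → Holds M' g) ∧ ∀ i, ∃ g ∈ G i, Holds M' g := by
  suffices ∀ s : Finset (Fin k), ∃ (m' : ℕ) (M' : (Fin n → ℂ) → (ℕ → ℂ) → Fin m' → ℂ),
      Reach q M' ∧ (∀ g, Holds M g → Holds M' g) ∧ ∀ i ∈ s, ∃ g ∈ G i, Holds M' g by
    obtain ⟨m', M', h1, h2, h3⟩ := this Finset.univ
    exact ⟨m', M', h1, h2, fun i => h3 i (Finset.mem_univ i)⟩
  intro s
  induction s using Finset.induction_on with
  | empty => exact ⟨m, M, hM, fun _ h => h, by simp⟩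
  | insert a s _ ih =>
    obtain ⟨m₁, M₁, h1, h2, h3⟩ := ih
    obtain ⟨m₂, M₂, k1, k2, k3⟩ := hG a m₁ M₁ h1
    refine ⟨m₂, M₂, k1, fun g hg => k2 g (h2 g hg), fun i hi => ?_⟩
    rcases Finset.mem_insert.1 hi with rfl | hi
    · exact k3
    · obtain ⟨g, hg, hh⟩ := h3 i hi
      exact ⟨g, hg, k2 g hh⟩

/-- The cell `l`, and with it the error of the operation, depends on the preceding program; hence
`G'` must allow every `l`. -/
theorem avail_op (o : Op J) {G : Fin (o.toBlackBox q).arity → Set ((Fin n → ℂ) → (ℕ → ℂ) → ℂ)}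
    (hG : ∀ i, Avail q (G i)) {G' : Set ((Fin n → ℂ) → (ℕ → ℂ) → ℂ)}
    (hG' : ∀ g : Fin (o.toBlackBox q).arity → (Fin n → ℂ) → (ℕ → ℂ) → ℂ,
      (∀ i, g i ∈ G i) → ∀ l : ℕ, (fun x δ => eval (fun i => g i x δ) (o.toBlackBox q).poly * (1 + δ l)) ∈ G') :
    Avail q G' := by
  intro m M hM
  obtain ⟨m', M', h1, h2, h3⟩ := exists_reach_holds_all hG hM
  choose g hg args hargs using h3
  refine ⟨_, _, h1.op o args, fun g' hg' => (h2 g' hg').snoc _, _, hG' g hg m', ?_⟩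
  simp only [← hargs]
  exact holds_snoc_last M' fun x δ =>
    eval (fun i => M' x δ (args i)) (o.toBlackBox q).poly * (1 + δ m')

theorem avail_signed_input {s : ℂ} (hs : s = 0 ∨ s = 1 ∨ s = -1) (t : Fin n) :
    Avail q {fun (x : Fin n → ℂ) (_ : ℕ → ℂ) => s * x t} := by
  rcases hs with rfl | rfl | rfl
  -- Rounding is relative, so multiplication by 0 yields an exact zero.
  · refine avail_op (.smul 0) (G := fun _ => {fun x _ => x t}) (fun _ => avail_input t) ?_
    intro g _ l
    change (fun (x : Fin n → ℂ) (δ : ℕ → ℂ) => eval _ (C 0 * X 0 : MvPolynomial (Fin 1) ℂ) * (1 + δ l)) = _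
    simp
  · simpa using avail_input t
  · simpa using (avail_input t).neg

theorem avail_approximants_aeval (o : Op J) {s : Fin (o.toBlackBox q).arity → ℂ}
    (hs : ∀ i, s i = 0 ∨ s i = 1 ∨ s i = -1) (t : Fin (o.toBlackBox q).arity → Fin n) :
    Avail q (approximants (aeval (fun i => C (s i) * X (t i)) (o.toBlackBox q).poly)) := by
  refine avail_op o (fun i => avail_signed_input (hs i) (t i)) fun g hg l => ?_
  obtain rfl : g = fun i x _ => s i * x (t i) := _root_.funext hg
  refine ⟨fun δ => 1 + δ l, by fun_prop, by simp, ?_⟩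
  ext x δ
  congr 1
  rw [← aeval_eq_eval, ← aeval_eq_eval, MvPolynomial.comp_aeval_apply]
  simp [aeval_eq_eval]

theorem avail_approximants_zero (hn : 0 < n) :
    Avail q (approximants (0 : MvPolynomial (Fin n) ℂ)) := by
  refine (avail_signed_input (q := q) (Or.inl rfl) ⟨0, hn⟩).mono ?_
  rintro _ rfl
  exact ⟨fun _ => 1, continuous_const, rfl, by simp⟩

theorem avail_approximants_X (t : Fin n) : Avail q (approximants (X t)) := by
  refine (avail_input t).mono ?_
  rintro _ rfl
  exact ⟨fun _ => 1, continuous_const, rfl, by simp⟩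

theorem avail_approximants_mul {p₁ p₂ : MvPolynomial (Fin n) ℂ} (h₁ : Avail q (approximants p₁))
    (h₂ : Avail q (approximants p₂)) : Avail q (approximants (p₁ * p₂)) := by
  refine avail_op .mul (G := fun i : Fin 2 => if i = 0 then approximants p₁ else approximants p₂)
    (fun i => ?_) fun g hg l => ?_
  · split_ifs
    exacts [h₁, h₂]
  · obtain ⟨E₁, c₁, e₁, hg₁⟩ : g (0 : Fin 2) ∈ approximants p₁ := hg (0 : Fin 2)
    obtain ⟨E₂, c₂, e₂, hg₂⟩ : g (1 : Fin 2) ∈ approximants p₂ := hg (1 : Fin 2)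
    refine ⟨fun δ => E₁ δ * E₂ δ * (1 + δ l), by fun_prop, by simp [e₁, e₂], ?_⟩
    ext x δ
    change eval (fun i : Fin 2 => g i x δ) (X 0 * X 1) * (1 + δ l) = _
    rw [map_mul, eval_X, eval_X, hg₁, hg₂, map_mul]
    ring

theorem avail_approximants_C_mul (c : ℂ) {p : MvPolynomial (Fin n) ℂ}
    (h : Avail q (approximants p)) : Avail q (approximants (C c * p)) := by
  refine avail_op (.smul c) (G := fun _ => approximants p) (fun _ => h) fun g hg l => ?_
  obtain ⟨E, hc, he, hg₁⟩ := hg (0 : Fin 1)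
  refine ⟨fun δ => E δ * (1 + δ l), by fun_prop, by simp [he], ?_⟩
  ext x δ
  change eval (fun i : Fin 1 => g i x δ) (C c * X 0) * (1 + δ l) = _
  rw [map_mul, eval_X, eval_C, hg₁, map_mul, eval_C]
  ring

theorem avail_approximants_of_associated {p₁ p₂ : MvPolynomial (Fin n) ℂ}
    (h : Avail q (approximants p₁)) (hp : Associated p₁ p₂) : Avail q (approximants p₂) := by
  obtain ⟨u, rfl⟩ := hp
  obtain ⟨c, -, hc⟩ := isUnit_iff_eq_C_of_isReduced.1 u.isUnit
  rw [hc, mul_comm]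
  exact avail_approximants_C_mul c h

theorem AccuratelyEvaluable.of_avail {p : MvPolynomial (Fin n) ℂ} (h : Avail q (approximants p))
    (cmp : Set (ℂ → ℂ → Prop)) (D : Set (Fin n → ℂ)) : AccuratelyEvaluable q cmp p D := by
  obtain ⟨m, M, hM, -, _, ⟨E, hc, he, rfl⟩, i, hi⟩ := h _ _ Reach.inputs
  obtain ⟨A, hA⟩ := hM.exists_alg cmp (.output i)
  have hrun : ∀ x δ, A.run δ x = eval x p * E δ := fun x δ => by
    rw [hA]
    exact hi x δ
  refine ⟨A, fun x _ => by rw [hrun, he, mul_one], fun η hη _ => ?_⟩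
  have hopen : IsOpen {δ | ‖E δ - 1‖ < η} := isOpen_lt (by fun_prop) continuous_const
  -- A neighbourhood in the product topology restricts finitely many errors only, so a single `ε`
  -- suffices; the relative error `‖E δ - 1‖` does not involve `x`.
  obtain ⟨I, u, hu, hsub⟩ := isOpen_pi_iff.1 hopen 0 (by simpa [he] using hη)
  have hsmall : ∀ a ∈ I, ∀ᶠ ε in 𝓝[>] (0 : ℝ), Metric.closedBall 0 ε ⊆ u a := by
    intro a ha
    obtain ⟨r, hr, hball⟩ := Metric.nhds_basis_closedBall.mem_iff.1
      ((hu a ha).1.mem_nhds (hu a ha).2)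
    filter_upwards [Ioo_mem_nhdsGT hr] with ε hε
    exact (Metric.closedBall_subset_closedBall hε.2.le).trans hball
  obtain ⟨ε, hε, hε01⟩ := (((Finset.eventually_all I).2 hsmall).and
    (Ioo_mem_nhdsGT (zero_lt_one' ℝ))).exists
  refine ⟨ε, hε01.1, hε01.2, fun x _ δ hδ => ?_⟩
  have hE : ‖E δ - 1‖ < η := hsub fun a ha => hε a ha (by simpa using hδ a)
  rw [hrun]
  calc ‖eval x p * E δ - eval x p‖ = ‖E δ - 1‖ * ‖eval x p‖ := by
        rw [← norm_mul]
        congr 1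
        ring
    _ ≤ η * ‖eval x p‖ := by gcongr

/-! ### Polynomials whose zero set is a union of basic varieties -/

/-- For a product, one factor vanishes at `x` and is a signed coordinate or zero. For an affine
operation, feeding 0 into the inputs represented in `T` computes the part `l` that depends on the
point; the rest is a fixed linear form in the free variables. -/
theorem IsBasic.exists_avail_factor (hq : ∀ j, (q j).poly.totalDegree ≤ 1) (hn : 0 < n)
    {V : Set (Fin n → ℂ)} (hV : IsBasic q V) {x : Fin n → ℂ} (hx : x ∈ V) :
    ∃ l : MvPolynomial (Fin n) ℂ, l.totalDegree ≤ 1 ∧ Avail q (approximants l) ∧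
      eval x l = 0 ∧ ∀ y, eval y l = 0 → y ∈ V := by
  classical
  obtain ⟨o, I, rfl⟩ := hV
  rw [Index.mem_variety_iff] at hx
  rcases o.eq_mul_or_totalDegree_le_one hq with rfl | ho
  · have hprod : ∀ θ : Fin 2 → MvPolynomial (Fin (Op.toBlackBox q .mul).arity) ℂ,
        aeval θ (Op.toBlackBox q .mul).poly = θ 0 * θ 1 := aeval_X_mul_X
    obtain ⟨i, hi⟩ : ∃ i : Fin 2, C (I.sign i) * I.point x (I.rep i) = 0 := by
      rcases mul_eq_zero.1 ((hprod _).symm.trans hx) with h | h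
      exacts [⟨0, h⟩, ⟨1, h⟩]
    have hmem : ∀ y, C (I.sign i) * I.point y (I.rep i) = 0 →
        y ∈ I.variety (Op.toBlackBox q .mul).poly := by
      intro y hy
      rw [Index.mem_variety_iff]
      refine (hprod _).trans ?_
      fin_cases i
      · exact mul_eq_zero_of_left hy _
      · exact mul_eq_zero_of_right _ hy
    by_cases hs : I.sign i = 0
    · refine ⟨0, by simp, avail_approximants_zero hn, by simp, fun y _ => hmem y ?_⟩
      rw [hs, C_0, zero_mul]
    · rw [mul_eq_zero, C_eq_zero, or_iff_right hs] at hi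
      unfold Index.point at hi
      by_cases hT : I.rep i ∈ I.T
      · rw [if_pos hT] at hi
        exact absurd hi (X_ne_zero _)
      rw [if_neg hT, C_eq_zero] at hi
      refine ⟨X (I.place (I.rep i)), by simp, avail_approximants_X _, ?_, fun y hy => hmem y ?_⟩
      · rw [eval_X]
        split_ifs at hi
        exacts [neg_eq_zero.1 hi, hi]
      · rw [eval_X] at hy
        unfold Index.point
        rw [if_neg hT, hy, neg_zero, ite_self, C_0, mul_zero]
  · generalize hk : (o.toBlackBox q).poly = p at *
    let s : Fin (o.toBlackBox q).arity → ℂ := fun i =>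
      if I.rep i ∈ I.T then 0 else if I.rep i ∈ I.N then -I.sign i else I.sign i
    have hs : ∀ i, s i = 0 ∨ s i = 1 ∨ s i = -1 := by
      intro i
      simp only [s]
      split_ifs
      · simp
      · rcases I.sign_cases i with h | h | h <;> simp [h]
      · exact I.sign_cases i
    let l : MvPolynomial (Fin n) ℂ := aeval (fun i => C (s i) * X (I.place (I.rep i))) p
    let free : MvPolynomial (Fin (o.toBlackBox q).arity) ℂ :=
      ∑ i, C (coeff (Finsupp.single i 1) p) * (if I.rep i ∈ I.T then C (I.sign i) * X (I.rep i)
        else 0)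
    have heval : ∀ y, aeval (fun i => C (I.sign i) * I.point y (I.rep i)) p =
        C (eval y l) + free := by
      intro y
      simp only [l, free]
      rw [aeval_eq_affine ho, aeval_eq_affine ho]
      simp only [algebraMap_eq, map_add, map_sum, map_mul, eval_C, eval_X]
      rw [add_assoc, ← Finset.sum_add_distrib]
      refine congrArg _ (Finset.sum_congr rfl fun i _ => ?_)
      rw [← mul_add]
      refine congrArg _ ?_
      simp only [s]
      unfold Index.point
      split_ifs <;> simp
    have hfree0 : constantCoeff free = 0 := by
      simp only [free, map_sum, map_mul]
      refine Finset.sum_eq_zero fun i _ => ?_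
      split_ifs <;> simp
    rw [heval] at hx
    -- The constant coefficient separates `l` from `free`; the identity at `x` then forces `free =
    -- 0`, so membership of any point is decided by `l` alone.
    have hlx : eval x l = 0 := by
      have := congrArg constantCoeff hx
      rwa [map_add, constantCoeff_C, hfree0, add_zero, map_zero] at this
    rw [hlx, C_0, zero_add] at hx
    refine ⟨l, ?_, ?_, hlx, fun y hy => ?_⟩
    · simp only [l]
      rw [aeval_eq_affine ho, algebraMap_eq]
      refine (totalDegree_add _ _).trans (max_le (by simp) ?_)
      refine totalDegree_finsetSum_le fun i _ => ?_
      rw [← mul_assoc, ← C_mul]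
      refine (totalDegree_mul _ _).trans ?_
      rw [totalDegree_C, totalDegree_X]
    · simp only [l, ← hk]
      exact avail_approximants_aeval o hs _
    · rw [Index.mem_variety_iff, heval, hy, hx, C_0, zero_add]

/-- Every zero of `f` lies on the zero set of an available factor of `p`. Hence `f` divides the
product of these finitely many factors, and so is associated to one of them. -/
theorem avail_of_irreducible_dvd (hq : ∀ j, (q j).poly.totalDegree ≤ 1) (hn : 0 < n)
    {p f : MvPolynomial (Fin n) ℂ} (hp : p ≠ 0) {𝒱 : Set (Set (Fin n → ℂ))}
    (h𝒱 : ∀ V ∈ 𝒱, IsBasic q V) (hV : {x | eval x p = 0} = ⋃₀ 𝒱)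
    (hf : Irreducible f) (hfp : f ∣ p) : Avail q (approximants f) := by
  classical
  let gs := (UniqueFactorizationMonoid.factors p).filter fun g => Avail q (approximants g)
  have hdvd : f ∣ gs.prod := by
    refine dvd_of_eval_eq_zero hf.prime fun x hx => ?_
    have hxp : x ∈ {x | eval x p = 0} := by
      obtain ⟨g, rfl⟩ := hfp
      rw [Set.mem_ofPred_eq, map_mul, hx, zero_mul]
    rw [hV] at hxp
    obtain ⟨V, hVmem, hxV⟩ := hxp
    obtain ⟨l, hdeg, hav, hlx, hl⟩ := (h𝒱 V hVmem).exists_avail_factor hq hn hxV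
    have hlp : ∀ y, eval y l = 0 → eval y p = 0 := by
      intro y hy
      have : y ∈ ⋃₀ 𝒱 := ⟨V, hVmem, hl y hy⟩
      rwa [← hV] at this
    have hl0 : l ≠ 0 := by
      rintro rfl
      exact hp (MvPolynomial.funext fun y => by rw [hlp y (map_zero _), map_zero])
    have hirr : Irreducible l := irreducible_of_totalDegree_le_one hl0
      (fun hu => (hu.map (eval x)).ne_zero hlx) hdeg
    obtain ⟨g, hg, hgl⟩ := UniqueFactorizationMonoid.exists_mem_factors_of_dvd hp hirr
      (dvd_of_eval_eq_zero hirr.prime hlp)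
    have hggs : g ∈ gs := Multiset.mem_filter.2 ⟨hg, avail_approximants_of_associated hav hgl⟩
    have hgx : eval x g = 0 := by
      obtain ⟨u, rfl⟩ := hgl
      rw [map_mul, hlx, zero_mul]
    refine zero_dvd_iff.1 ?_
    rw [← hgx]
    exact map_dvd _ (Multiset.dvd_prod hggs)
  obtain ⟨g, hg, hfg⟩ := hf.prime.exists_mem_multiset_dvd hdvd
  obtain ⟨hg1, hg2⟩ := Multiset.mem_filter.1 hg
  exact avail_approximants_of_associated hg2
    (hf.associated_of_dvd (UniqueFactorizationMonoid.irreducible_of_factor g hg1) hfg).symm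

/-- Units are set apart because a constant need not be computable on its own; beside an available
factor it is absorbed by a scalar multiplication. -/
theorem isUnit_or_avail {p : MvPolynomial (Fin n) ℂ} (hp : p ≠ 0)
    (h : ∀ f, Irreducible f → f ∣ p → Avail q (approximants f)) :
    IsUnit p ∨ Avail q (approximants p) := by
  induction p using WfDvdMonoid.induction_on_irreducible with
  | zero => exact absurd rfl hp
  | unit u hu => exact Or.inl hu
  | mul a i ha hi ih =>
    have hiA := h i hi (dvd_mul_right _ _)
    rcases ih ha fun f hf hfa => h f hf (hfa.mul_left i) with hu | hA
    · exact Or.inr (avail_approximants_of_associated hiA (associated_mul_unit_right i a hu))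
    · exact Or.inr (avail_approximants_mul hiA hA)

/-- On zero inputs the black box returns its constant term up to rounding, which is then rescaled to
`c`. -/
theorem avail_approximants_C (hn : 0 < n) {j : J} (hj : constantCoeff (q j).poly ≠ 0) (c : ℂ) :
    Avail q (approximants (C c : MvPolynomial (Fin n) ℂ)) := by
  have h := avail_approximants_aeval (q := q) (.box j) (s := fun _ => 0) (fun _ => Or.inl rfl)
    (fun _ => (⟨0, hn⟩ : Fin n))
  have hconst : aeval (fun _ => C 0 * X (⟨0, hn⟩ : Fin n)) (q j).poly =
      (C (constantCoeff (q j).poly) : MvPolynomial (Fin n) ℂ) := by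
    simp only [C_0, zero_mul]
    exact aeval_zero' _
  have h' := avail_approximants_C_mul (c / constantCoeff (q j).poly) (hconst ▸ h)
  rwa [← C_mul, div_mul_cancel₀ _ hj] at h'

end StraightLine

end AccEval

end

theorem mainTheorem8 {J : Type*} (q : J → AccEval.BlackBox)
    (hq : ∀ j, (q j).poly.totalDegree ≤ 1)
    (cmp : Set (ℂ → ℂ → Prop))
    {n : ℕ} (hn : 0 < n) (p : MvPolynomial (Fin n) ℂ)
    (hp : (∃ j, MvPolynomial.constantCoeff (q j).poly ≠ 0) ∨
      ∀ c : ℂ, c ≠ 0 → p ≠ MvPolynomial.C c) :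
    AccEval.AccuratelyEvaluable q cmp p Set.univ ↔
      ∃ 𝒱 : Set (Set (Fin n → ℂ)), (∀ V ∈ 𝒱, AccEval.IsBasic q V) ∧
        {x | MvPolynomial.eval x p = 0} = ⋃₀ 𝒱 := by
  refine ⟨fun h => h.exists_eq_sUnion hq hn, ?_⟩
  rintro ⟨𝒱, h𝒱, hV⟩
  refine AccEval.AccuratelyEvaluable.of_avail ?_ cmp Set.univ
  rcases eq_or_ne p 0 with rfl | hp0
  · exact AccEval.avail_approximants_zero hn
  rcases AccEval.isUnit_or_avail hp0 fun f hf hfp =>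
    AccEval.avail_of_irreducible_dvd hq hn hp0 h𝒱 hV hf hfp with hu | hA
  · obtain ⟨c, hc, rfl⟩ := MvPolynomial.isUnit_iff_eq_C_of_isReduced.1 hu
    rcases hp with ⟨j, hj⟩ | hp
    · exact AccEval.avail_approximants_C hn hj c
    · exact absurd rfl (hp c hc.ne_zero)
  · exact hA
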